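/- Let $A$ be an Artinian local ring with algebraically closed residue field $k$. Its characteristic is either $p^{m+1}$ for a prime $p$ and an integer $m\ge 0$, or $0$, in which case put $m=0$ (and let $p$ be any prime, the choice being immaterial). Let $W$ denote the functor of $p$-typical Witt vectors with $m+1$ components $(x_0,\dots,x_m)$, so that $W(T)=T$ as a ring if $m=0$. Regard $A$ as a $W(k)$-algebra through a ring homomorphism $W(k)\to A$ that lifts the map $x\mapsto x_0$ to the residue field $k$; there is exactly one such homomorphism if $\operatorname{char}A=p^{m+1}$, while if $\operatorname{char}A=0$ it is any choice of a coefficient field $k\to A$. For a ring $R$, an $R$-functor is a functor from (commutative) $R$-algebras to sets, and affine $R$-schemes are identified with the representable $R$-functors. The Greenberg functor $\mathcal F$ sends an $A$-functor $\mathbf X$ to the $k$-functor $$(\mathcal F\mathbf X)(T)=\mathbf X\bigl(A\otimes_{W(k)}W(T)\bigr)\qquad (T\text{ a }k\text{-algebra});$$ it sends subfunctors to subfunctors and group functors to group functors. For a group functor $\mathbf G$ over $R$ and a subfunctor $\mathbf Y\subseteq\mathbf G$, the normaliser $N_{\mathbf G}(\mathbf Y)$ is the subfunctor of $\mathbf G$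 given, for every $R$-algebra $S$, by $$N_{\mathbf G}(\mathbf Y)(S)=\{g\in\mathbf G(S)\mid g_{S'}\,\mathbf Y(S')\,g_{S'}^{-1}=\mathbf Y(S')\text{ for every }R\text{-algebra map }S\to S'\}.$$ **Corollary.** Let $\mathbf G$ be an affine group scheme of finite type over $A$, and let $\mathbf H$ be a closed subgroup scheme of $\mathbf G$ that is smooth over $A$. Assume that $N_{\mathbf G}(\mathbf H)$ is representable by a closed subscheme of $\mathbf G$ that is smooth over $A$. Then $$\mathcal F N_{\mathbf G}(\mathbf H)=N_{\mathcal F\mathbf G}(\mathcal F\mathbf H)$$ as subfunctors of $\mathcal F\mathbf G$. -/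

import Mathlib

open CategoryTheory TensorProduct

universe u

noncomputable section

/-! ### Functors of points -/

/-- An `R`-functor: a covariant functor from `R`-algebras to sets. -/
abbrev RFunctor (R : Type u) [CommRing R] := CommAlgCat.{u} R ⥤ Type u

/-- An `R`-group functor: every `G(S)` carries a group structure, functorially in `S`. -/
abbrev RGroupFunctor (R : Type u) [CommRing R] := CommAlgCat.{u} R ⥤ GrpCat.{u}

/-- The underlying `R`-functor of an `R`-group functor. -/
abbrev RGroupFunctor.toRFunctor {R : Type u} [CommRing R] (G : RGroupFunctor R) : RFunctor R :=
  G ⋙ forget GrpCat.{u}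

/-- `X` is an affine scheme of finite type over `R`: it is isomorphic to
`S ↦ Hom_R(B, S)` for some `R`-algebra `B` of finite type. -/
def RFunctor.IsAffineOfFiniteType {R : Type u} [CommRing R] (X : RFunctor R) : Prop :=
  ∃ B : CommAlgCat.{u} R, Algebra.FiniteType R B ∧ Nonempty (X.CorepresentableBy B)

/-- The subfunctor `Y` of the affine scheme `X` is (represented by) a closed smooth subscheme:
identifying `X` with `S ↦ Hom_R(B, S)`, there is an ideal `I` of `B` such that `Y(S)` consists of
the points of `X(S)` that vanish on `I`, and `Y = Spec (B ⧸ I)` is smooth over `R`. -/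
def IsClosedSmoothSubscheme {R : Type u} [CommRing R] {X : RFunctor R} (Y : Subfunctor X) : Prop :=
  ∃ (B : CommAlgCat.{u} R) (e : X.CorepresentableBy B) (I : Ideal B),
    (∀ (S : CommAlgCat.{u} R) (f : B ⟶ S), e.homEquiv f ∈ Y.obj S ↔ ∀ b ∈ I, f.hom b = 0) ∧
    Algebra.Smooth R (B ⧸ I)

/-- The subfunctor `H` of the group functor `G` is a subgroup functor. -/
def IsSubgroupFunctor {R : Type u} [CommRing R] (G : RGroupFunctor R)
    (H : Subfunctor G.toRFunctor) : Prop :=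
  ∀ S : CommAlgCat.{u} R, ∃ K : Subgroup (G.obj S), ∀ g : G.obj S, g ∈ K ↔ g ∈ H.obj S

/-- The (strict) normaliser of a subfunctor `Y` of a group functor `G`:
`N_G(Y)(S)` is the set of `g ∈ G(S)` such that `g_{S'} Y(S') g_{S'}⁻¹ = Y(S')`
for all `R`-algebra maps `S ⟶ S'`. -/
def normaliser {R : Type u} [CommRing R] (G : RGroupFunctor R)
    (Y : Subfunctor G.toRFunctor) : Subfunctor G.toRFunctor where
  obj S := {g : G.obj S | ∀ (S' : CommAlgCat.{u} R) (f : S ⟶ S'),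
    (fun y : G.obj S' => G.map f g * y * (G.map f g)⁻¹) '' Y.obj S' = Y.obj S'}
  map {S T} i g hg := by
    intro S' f
    have h := hg S' (i ≫ f)
    rw [G.map_comp] at h
    exact h

/-! ### Truncated Witt vectors as a functor -/

/-- Functoriality of truncated Witt vectors: apply a ring homomorphism to each component. -/
def TruncatedWittVector.mapRingHom (p : ℕ) [Fact p.Prime] (n : ℕ) {R S : Type u} [CommRing R]
    [CommRing S] (f : R →+* S) : TruncatedWittVector p n R →+* TruncatedWittVector p n S :=
  RingHom.liftOfRightInverse (WittVector.truncate n) TruncatedWittVector.out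
    TruncatedWittVector.truncateFun_out
    ⟨(WittVector.truncate n).comp (WittVector.map f), by
      intro x hx
      rw [WittVector.mem_ker_truncate] at hx
      change WittVector.truncate n (WittVector.map f x) = 0
      rw [← RingHom.mem_ker, WittVector.mem_ker_truncate]
      intro i hi
      rw [WittVector.map_coeff, hx i hi, map_zero]⟩

theorem TruncatedWittVector.coeff_mapRingHom (p : ℕ) [Fact p.Prime] (n : ℕ) {R S : Type u}
    [CommRing R] [CommRing S] (f : R →+* S) (x : TruncatedWittVector p n R) (i : Fin n) :
    (TruncatedWittVector.mapRingHom p n f x).coeff i = f (x.coeff i) := by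
  obtain ⟨y, rfl⟩ := WittVector.truncate_surjective p n R x
  have h : TruncatedWittVector.mapRingHom p n f (WittVector.truncate n y)
      = WittVector.truncate n (WittVector.map f y) :=
    RingHom.liftOfRightInverse_comp_apply _ _ _ _ _
  rw [h, WittVector.coeff_truncate, WittVector.coeff_truncate, WittVector.map_coeff]

/-- The `W_n(k)`-algebra `W_n(T)` of a `k`-algebra `T`. -/
def wittAlgObj (p : ℕ) [Fact p.Prime] (n : ℕ) (k : Type u) [CommRing k] (T : CommAlgCat.{u} k) :
    CommAlgCat.{u} (TruncatedWittVector p n k) :=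
  letI : Algebra (TruncatedWittVector p n k) (TruncatedWittVector p n T) :=
    (TruncatedWittVector.mapRingHom p n (algebraMap k T)).toAlgebra
  CommAlgCat.of (TruncatedWittVector p n k) (TruncatedWittVector p n T)

/-- The map `W_n(T) → W_n(T')` induced by a homomorphism of `k`-algebras `T → T'`. -/
def wittAlgMap (p : ℕ) [Fact p.Prime] (n : ℕ) (k : Type u) [CommRing k] {T T' : CommAlgCat.{u} k}
    (f : T ⟶ T') : wittAlgObj p n k T →ₐ[TruncatedWittVector p n k] wittAlgObj p n k T' where
  __ := TruncatedWittVector.mapRingHom p n (f.hom : T →+* T')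
  commutes' x := by
    change TruncatedWittVector.mapRingHom p n (f.hom : T →+* T')
      (TruncatedWittVector.mapRingHom p n (algebraMap k T) x) =
      TruncatedWittVector.mapRingHom p n (algebraMap k T') x
    ext i
    simp only [TruncatedWittVector.coeff_mapRingHom]
    exact f.hom.commutes _

/-- `T ↦ W_n(T)`, `p`-typical Witt vectors with `n` components, as a functor from `k`-algebras to
`W_n(k)`-algebras. -/
def wittAlg (p : ℕ) [Fact p.Prime] (n : ℕ) (k : Type u) [CommRing k] :
    CommAlgCat.{u} k ⥤ CommAlgCat.{u} (TruncatedWittVector p n k) where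
  obj T := wittAlgObj p n k T
  map {T T'} f := ConcreteCategory.ofHom (C := CommAlgCat.{u} (TruncatedWittVector p n k))
    (X := wittAlgObj p n k T) (Y := wittAlgObj p n k T') (wittAlgMap p n k f)
  map_id T := by
    apply CommAlgCat.hom_ext
    apply AlgHom.ext
    intro (x : TruncatedWittVector p n T)
    change TruncatedWittVector.mapRingHom p n ((𝟙 T : T ⟶ T).hom : T →+* T) x = x
    ext i
    rw [TruncatedWittVector.coeff_mapRingHom]
    rfl
  map_comp {T T' T''} f g := by
    apply CommAlgCat.hom_ext
    apply AlgHom.ext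
    intro (x : TruncatedWittVector p n T)
    change TruncatedWittVector.mapRingHom p n ((f ≫ g).hom : T →+* T'') x =
      TruncatedWittVector.mapRingHom p n (g.hom : T' →+* T'')
        (TruncatedWittVector.mapRingHom p n (f.hom : T →+* T') x)
    ext i
    simp only [TruncatedWittVector.coeff_mapRingHom]
    rfl

/-- Extension of scalars `S ↦ A ⊗_W S` from `W`-algebras to `A`-algebras. -/
def extendScalarsAlg (W A : Type u) [CommRing W] [CommRing A] [Algebra W A] :
    CommAlgCat.{u} W ⥤ CommAlgCat.{u} A where
  obj S := CommAlgCat.of A (A ⊗[W] S)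
  map f := CommAlgCat.ofHom (Algebra.TensorProduct.map (AlgHom.id A A) f.hom)
  map_id S := by
    apply CommAlgCat.hom_ext
    exact Algebra.TensorProduct.map_id
  map_comp f g := by
    apply CommAlgCat.hom_ext
    apply Algebra.TensorProduct.ext
    · ext
    · ext; simp

/-! ### The Witt algebra structure of an Artinian local ring

For an Artinian local ring `A` with perfect residue field `k` and characteristic `p ^ (m + 1)`
there is exactly one homomorphism from the ring of Witt vectors over `k` with `m + 1` components to
`A` that induces the identity on residue fields. In characteristic `0` such homomorphisms exist. -/

section WittStructure

open IsLocalRing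

theorem natCast_mem_maximalIdeal_of_ringChar {A : Type*} [CommRing A] [IsLocalRing A] {p m : ℕ}
    (h : ringChar A = p ^ (m + 1)) : (p : A) ∈ maximalIdeal A := by
  have : ((p:A)) ^ (m + 1) = 0 := by
    rw [← Nat.cast_pow, ← h]; exact ringChar.Nat.cast_ringChar
  rw [mem_maximalIdeal, mem_nonunits_iff]
  exact fun hu => not_isUnit_zero (this ▸ hu.pow (m + 1))

/-- In residue characteristic `p`, the canonical homomorphism `W(k) → A`, with `m + 1` Witt
components, exists: it is the lift of the identity of the residue field `k`. -/
theorem exists_wittStructure_of_ringChar_eq_prime_pow {A : Type*} [CommRing A] [IsLocalRing A] [IsArtinianRing A]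
    [PerfectField (ResidueField A)] (p : ℕ) [Fact p.Prime] (m : ℕ)
    (h : ringChar A = p ^ (m + 1)) :
    ∃ φ : TruncatedWittVector p (m + 1) (ResidueField A) →+* A, ∀ x, residue A (φ x) = x.coeff 0 := by
  have hp := natCast_mem_maximalIdeal_of_ringChar h
  have : CharP (ResidueField A) p := by
    refine (CharP.charP_iff_prime_eq_zero Fact.out).2 ?_
    rw [← map_natCast (residue A), residue_eq_zero_iff]; exact hp
  have : PerfectRing (ResidueField A) p := PerfectField.toPerfectRing p
  have hp0 : (p : A) ^ (m + 1) = 0 := by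
    rw [← Nat.cast_pow, ← h]; exact ringChar.Nat.cast_ringChar
  obtain ⟨N, hN⟩ : ∃ N, maximalIdeal A ^ N = 0 := by
    have := IsArtinianRing.isNilpotent_jacobson_bot (R := A)
    rwa [jacobson_eq_maximalIdeal _ bot_ne_top] at this
  have hsurj : Function.Surjective (WittVector.map (p := p) (residue A)) :=
    WittVector.map_surjective _ residue_surjective
  let g : WittVector p (ResidueField A) →+* A :=
    RingHom.liftOfSurjective (WittVector.map (p := p) (residue A)) hsurj
      ⟨WittVector.ghostComponent N, by
        intro x hx
        rw [RingHom.mem_ker] at hx ⊢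
        have hx' : ∀ i, x.coeff i ∈ maximalIdeal A := fun i => by
          rw [← residue_eq_zero_iff, ← WittVector.map_coeff, hx, WittVector.zero_coeff]
        rw [WittVector.ghostComponent_apply, aeval_wittPolynomial]
        refine Finset.sum_eq_zero fun i hi => ?_
        have : (p : A) ^ i * x.coeff i ^ p ^ (N - i) ∈ maximalIdeal A ^ N := by
          refine Ideal.pow_le_pow_right (m := N) (n := i + p ^ (N - i)) ?_ ?_
          · have := (Nat.lt_pow_self (Fact.out : p.Prime).one_lt : N - i < p ^ (N-i))
            omega
          · rw [pow_add]
            exact Ideal.mul_mem_mul (Ideal.pow_mem_pow hp _) (Ideal.pow_mem_pow (hx' i) _)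
        rw [hN] at this
        simpa using this⟩
  have hg : ∀ x, residue A (g x) = x.coeff 0 ^ p ^ N := by
    intro x
    obtain ⟨y, rfl⟩ := hsurj x
    have : g (WittVector.map (residue A) y) = WittVector.ghostComponent N y :=
      RingHom.liftOfSurjective_comp_apply ..
    rw [this, WittVector.ghostComponent_apply, aeval_wittPolynomial, map_sum,
      Finset.sum_eq_single_of_mem 0 (by simp)]
    · simp
    · intro i _ hi
      have : residue A (p : A) = 0 := (residue_eq_zero_iff _).2 hp
      rw [map_mul, map_pow, this, zero_pow hi, zero_mul]
  let F : WittVector p (ResidueField A) →+* WittVector p (ResidueField A) :=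
    WittVector.map ((iterateFrobeniusEquiv (ResidueField A) p N).symm : _ →+* _)
  have hθ : ∀ x, residue A (g (F x)) = x.coeff 0 := by
    intro x
    rw [hg, WittVector.map_coeff]
    exact (iterateFrobeniusEquiv_apply ..).symm.trans ((iterateFrobeniusEquiv (ResidueField A) p N).apply_symm_apply _)
  refine ⟨RingHom.liftOfSurjective (WittVector.truncate (m + 1))
    (WittVector.truncate_surjective p _ _) ⟨g.comp F, ?_⟩, ?_⟩
  · intro x hx
    rw [WittVector.mem_ker_truncate, ← WittVector.mem_span_p_pow_iff_le_coeff_eq_zero,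
      Ideal.mem_span_singleton] at hx
    obtain ⟨c, rfl⟩ := hx
    rw [RingHom.mem_ker, map_mul, map_pow, map_natCast, hp0, zero_mul]
  · intro x
    obtain ⟨y, rfl⟩ := WittVector.truncate_surjective p _ _ x
    rw [RingHom.liftOfSurjective_comp_apply]
    rw [WittVector.coeff_truncate]; exact hθ y

/-- In residue characteristic `p`, the canonical homomorphism is unique. -/
theorem wittStructure_unique_of_ringChar_eq_prime_pow {A : Type*} [CommRing A] [IsLocalRing A] [IsArtinianRing A]
    [PerfectField (ResidueField A)] (p : ℕ) [Fact p.Prime] (m : ℕ)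
    (h : ringChar A = p ^ (m + 1))
    (φ ψ : TruncatedWittVector p (m + 1) (ResidueField A) →+* A)
    (hφ : ∀ x, residue A (φ x) = x.coeff 0)  (hψ : ∀ x, residue A (ψ x) = x.coeff 0) : φ = ψ := by
  have hp := natCast_mem_maximalIdeal_of_ringChar h
  have : CharP (ResidueField A) p := by
    refine (CharP.charP_iff_prime_eq_zero Fact.out).2 ?_
    rw [← map_natCast (residue A), residue_eq_zero_iff]; exact hp
  have : PerfectRing (ResidueField A) p := PerfectField.toPerfectRing p
  obtain ⟨N, hN⟩ : ∃ N, maximalIdeal A ^ N = 0 := by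
    have := IsArtinianRing.isNilpotent_jacobson_bot (R := A)
    rwa [jacobson_eq_maximalIdeal _ bot_ne_top] at this
  have key : φ.comp (WittVector.truncate (m + 1)) = ψ.comp (WittVector.truncate (m + 1)) := by
    refine WittVector.eq_of_apply_teichmuller_eq _ _ ⟨N, ?_⟩ fun x => ?_
    · simpa [hN] using Ideal.pow_mem_pow hp N
    · obtain ⟨y, rfl⟩ := (iterateFrobeniusEquiv (ResidueField A) p N).surjective x
      rw [iterateFrobeniusEquiv_apply, iterateFrobenius_def, map_pow, map_pow, map_pow]
      set a := (φ.comp (WittVector.truncate (m + 1))) (WittVector.teichmuller p y)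
      set b := (ψ.comp (WittVector.truncate (m + 1))) (WittVector.teichmuller p y)
      have hab : a - b ∈ maximalIdeal A := by
        rw [← residue_eq_zero_iff, map_sub, sub_eq_zero]
        simp only [a, b, RingHom.comp_apply, hφ, hψ]
      have hmem : ∀ n, a ^ p ^ n - b ^ p ^ n ∈ maximalIdeal A ^ (n + 1) := by
        intro n
        induction n with
        | zero => simpa using hab
        | succ n ih =>
          rw [pow_succ p, pow_mul, pow_mul, ← (Commute.all _ _).geom_sum₂_mul, mul_comm,
            pow_succ _ (n + 1)]
          refine Ideal.mul_mem_mul ih ?_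
          have hr : residue A a = residue A b := by
            rwa [← sub_eq_zero, ← map_sub, residue_eq_zero_iff]
          rw [← residue_eq_zero_iff]
          simp only [map_sum, map_mul, map_pow, hr]
          rw [geom_sum₂_self, CharP.cast_eq_zero, zero_mul]
      have := Ideal.pow_le_pow_right (Nat.le_succ N) (hmem N)
      rw [hN] at this
      exact sub_eq_zero.1 (by simpa using this)
  ext x
  obtain ⟨y, rfl⟩ := WittVector.truncate_surjective p _ _ x
  exact congrArg (fun f => f y) key

/-- In characteristic zero (where the length is `1` and `W = k`), the identity of the residue
field lifts to a homomorphism `k → A`, which need not be unique. -/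
theorem exists_wittStructure_of_ringChar_eq_zero {A : Type*} [CommRing A] [IsLocalRing A] [IsArtinianRing A]
    (p : ℕ) [Fact p.Prime]
    (h : ringChar A = 0) :
    ∃ φ : TruncatedWittVector p 1 (ResidueField A) →+* A, ∀ x, residue A (φ x) = x.coeff 0 := by
  obtain ⟨N, hN⟩ : ∃ N, maximalIdeal A ^ N = 0 := by
    have := IsArtinianRing.isNilpotent_jacobson_bot (R := A)
    rwa [jacobson_eq_maximalIdeal _ bot_ne_top] at this
  have hch : CharP A 0 := h ▸ ringChar.charP A
  have : CharZero A := CharP.charP_to_charZero A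
  have hu : ∀ n : ℕ, n ≠ 0 → IsUnit (n : A) := by
    intro n hn
    by_contra hnu
    have h1 : (n : A) ∈ maximalIdeal A := hnu
    have := Ideal.pow_mem_pow h1 N
    rw [hN, ← Nat.cast_pow] at this
    have h2 : n ^ N = 0 := by exact_mod_cast (show ((n ^ N : ℕ) : A) = 0 by simpa using this)
    exact hn (eq_zero_of_pow_eq_zero h2)
  have : CharZero (ResidueField A) := by
    refine charZero_of_inj_zero fun n hn => ?_
    by_contra h0
    rw [← map_natCast (residue A)] at hn
    exact ((hu n h0).map (residue A)).ne_zero hn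
  let q : ℚ →+* A := (IsLocalization.lift (M := nonZeroDivisors ℤ) (S := ℚ) (g := Int.castRingHom A) (by
    intro y
    have := hu y.1.natAbs (by simpa using nonZeroDivisors.coe_ne_zero y)
    rcases Int.natAbs_eq y.1 with h | h <;> rw [h] <;> simpa using this))
  let _ : Algebra ℚ A := q.toAlgebra
  have hsm : Algebra.FormallySmooth ℚ (ResidueField A) := by
    obtain ⟨s, hs⟩ := exists_isTranscendenceBasis ℚ (ResidueField A)
    have : Algebra.IsAlgebraic (IntermediateField.adjoin ℚ (Set.range ((↑) : s → ResidueField A))) (ResidueField A) := hs.isAlgebraic_field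
    exact .of_algebraicIndependent_of_isSeparable hs.1
  let r : A →ₐ[ℚ] ResidueField A := (residue A).toRatAlgHom
  let σ := Algebra.FormallySmooth.liftOfSurjective (AlgHom.id ℚ (ResidueField A)) r (residue_surjective) ⟨N, by
     have : RingHom.ker (r : A →+* ResidueField A) = maximalIdeal A := ker_residue
     exact (congrArg (· ^ N) this).trans hN⟩
  refine ⟨(σ : ResidueField A →+* A).comp (RingHom.liftOfSurjective (WittVector.truncate 1)
    (WittVector.truncate_surjective p _ _) ⟨WittVector.constantCoeff, ?_⟩), ?_⟩
  · intro x hx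
    rw [WittVector.mem_ker_truncate] at hx
    exact hx 0 one_pos
  · intro x
    obtain ⟨y, rfl⟩ := WittVector.truncate_surjective p _ _ x
    rw [RingHom.comp_apply, RingHom.liftOfSurjective_comp_apply, WittVector.coeff_truncate]
    exact Algebra.FormallySmooth.liftOfSurjective_apply _ r _ _ _

end WittStructure

/-! ### The Greenberg functor -/

section Greenberg

variable (p : ℕ) [Fact p.Prime] (n : ℕ) (k A : Type u) [CommRing k] [CommRing A]
  [Algebra (TruncatedWittVector p n k) A]

/-- The ring functor `T ↦ A ⊗_{W_n(k)} W_n(T)` from `k`-algebras to `A`-algebras. -/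
def greenbergRing : CommAlgCat.{u} k ⥤ CommAlgCat.{u} A :=
  wittAlg p n k ⋙ extendScalarsAlg (TruncatedWittVector p n k) A

/-- The Greenberg functor from `A`-functors to `k`-functors,
`(F X)(T) = X(A ⊗_{W_n(k)} W_n(T))`. -/
def greenberg : RFunctor A ⥤ RFunctor k :=
  (Functor.whiskeringLeft _ _ (Type u)).obj (greenbergRing p n k A)

/-- The Greenberg functor sends group functors to group functors. -/
def greenbergGroup : RGroupFunctor A ⥤ RGroupFunctor k :=
  (Functor.whiskeringLeft _ _ GrpCat.{u}).obj (greenbergRing p n k A)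

/-- The Greenberg functor sends a subfunctor `Y` of `X` to the subfunctor `F Y` of `F X`. -/
def greenbergSub {X : RFunctor A} (Y : Subfunctor X) :
    Subfunctor ((greenberg p n k A).obj X) where
  obj T := Y.obj ((greenbergRing p n k A).obj T)
  map i := Y.map ((greenbergRing p n k A).map i)

end Greenberg

/-! ### Teichmüller expansions in Witt vectors. -/

namespace WittVector

variable {p : ℕ} [Fact p.Prime]

/-! Write `F T` for `A ⊗ W(T)`. The inclusion of `F N_G(H)` in the other normaliser is formal: the
algebras `F U` are among those on which a normalising point is tested. For the converse, let `g` be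
a point over `R = F T` that normalises `H` on every `F U` with `U` over `T`. With `C` the coordinate
ring of `H`, conjugation by `g` preserves `H` as soon as it sends the universal point of `H` over `R
⊗ C` into `H`. This is the vanishing of some elements of `R ⊗ C`, so it may be tested after an
injection `R ⊗ C → F U` over `R`, where it holds by assumption (`conj_mem_of_injective`).

Such an injection exists because `C` is smooth (`exists_injective_greenbergRing`). The special fibre
of `C` is reduced, hence embeds in a `k`-algebra `T'`: its perfect closure, or itself if `m = 0`.
The embedding lifts to `C → F T'` (`exists_lift_greenberg`). As `W(T')` is free over `W(k)` on
Teichmüller elements, `F T'` is flat over `A`, and the lift stays injective after tensoring with `R`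
(`injective_lTensor_of_flat`). Finally `R ⊗ F T'` embeds in `F (T ⊗ T')`, since the same Teichmüller
elements form a basis of `W(T ⊗ T')` over `W(T)` (`injective_lift_tensor_of_basis`). -/

theorem frobenius_teichmuller {R : Type*} [CommRing R] (r : R) :
    frobenius (teichmuller p r) = teichmuller p (r ^ p) := by
  -- Universal case: ghost components are injective over ℚ, hence the identity holds over integral
  -- polynomial rings, and every `R` is a quotient of one.
  have hQ : ∀ x : MvPolynomial R ℚ, frobenius (teichmuller p x) = teichmuller p (x ^ p) := by
    intro x
    apply (ghostMap.bijective_of_invertible p (MvPolynomial R ℚ)).1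
    funext n
    simp only [ghostMap_apply, ghostComponent_frobenius, ghostComponent_teichmuller]
    rw [← pow_mul, pow_succ']
  have hZ : ∀ x : MvPolynomial R ℤ, frobenius (teichmuller p x) = teichmuller p (x ^ p) := by
    intro x
    refine map_injective (MvPolynomial.map (Int.castRingHom ℚ))
      (MvPolynomial.map_injective _ Int.cast_injective) ?_
    rw [(frobenius_isPoly p).map, map_teichmuller, map_teichmuller, hQ, (MvPolynomial.map _).map_pow]
  obtain ⟨x, rfl⟩ := MvPolynomial.counit_surjective R r
  rw [← map_teichmuller, ← (frobenius_isPoly p).map, hZ, map_teichmuller, map_pow]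

theorem exists_eq_verschiebung {R : Type*} [CommRing R] {x : WittVector p R}
    (h : x.coeff 0 = 0) : ∃ y, x = verschiebung y :=
  ⟨x.shift 1, eq_iterate_verschiebung (n := 1) fun i hi => by
    rwa [Nat.lt_one_iff.1 hi]⟩

theorem coeff_zero_sum {R ι : Type*} [CommRing R] (s : Finset ι) (f : ι → WittVector p R) :
    (∑ i ∈ s, f i).coeff 0 = ∑ i ∈ s, (f i).coeff 0 :=
  map_sum (constantCoeff (p := p) (R := R)) f s

theorem coeff_zero_sub {R : Type*} [CommRing R] (x y : WittVector p R) :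
    (x - y).coeff 0 = x.coeff 0 - y.coeff 0 :=
  map_sub (constantCoeff (p := p) (R := R)) x y

/-- Projection formula `V(a · F[e]) = V(a) · [e]`. Dividing by `V` thus replaces `e` by `e ^ p`,
which is why the results below ask for all the twists `e ^ p ^ j` to be bases. -/
theorem verschiebung_map_mul_teichmuller_pow {T U : Type*} [CommRing T] [CommRing U] (f : T →+* U)
    (x : WittVector p T) (e : U) :
    verschiebung (map f x * teichmuller p (e ^ p)) = map f (verschiebung x) * teichmuller p e := by
  rw [← frobenius_teichmuller, verschiebung_mul_frobenius, map_verschiebung]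

variable {ι T U : Type*} [CommRing T] [CommRing U] [Algebra T U]

/-- Linear independence, up to order `n`, of Teichmüller lifts of a family whose Frobenius twists
are bases. -/
theorem coeff_eq_zero_of_coeff_sum_teichmuller_eq_zero (n : ℕ) :
    ∀ (e : ι → U), (∀ j < n, ∃ b : Module.Basis ι T U, ∀ i, b i = e i ^ p ^ j) →
    ∀ (s : Finset ι) (a : ι → WittVector p T),
      (∀ m < n, (∑ i ∈ s, map (algebraMap T U) (a i) * teichmuller p (e i)).coeff m = 0) →
      ∀ i ∈ s, ∀ m < n, (a i).coeff m = 0 := by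
  induction n with
  | zero => intro _ _ _ _ _ _ _ m hm; omega
  | succ n ih =>
    intro e he s a ha
    have h0 : ∀ i ∈ s, (a i).coeff 0 = 0 := by
      obtain ⟨b, hb⟩ := he 0 n.succ_pos
      have h := ha 0 n.succ_pos
      rw [coeff_zero_sum] at h
      simp only [mul_coeff_zero, map_coeff, teichmuller_coeff_zero] at h
      refine linearIndependent_iff'.1 b.linearIndependent s (fun i => (a i).coeff 0) ?_
      simpa [hb, Algebra.smul_def] using h
    -- The junk value `0` outside `s` only serves to choose `y` on all of `ι`.
    have h1 : ∀ i, ∃ y, i ∈ s → a i = verschiebung y := fun i => by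
      by_cases hi : i ∈ s
      · obtain ⟨y, hy⟩ := exists_eq_verschiebung (h0 i hi)
        exact ⟨y, fun _ => hy⟩
      · exact ⟨0, fun h => absurd h hi⟩
    choose y hy using h1
    have h2 : ∑ i ∈ s, map (algebraMap T U) (a i) * teichmuller p (e i) =
        verschiebung (∑ i ∈ s, map (algebraMap T U) (y i) * teichmuller p (e i ^ p)) := by
      rw [map_sum]
      refine Finset.sum_congr rfl fun i hi => ?_
      rw [verschiebung_map_mul_teichmuller_pow, hy i hi]
    intro i hi m hm
    rcases m with _ | m
    · exact h0 i hi
    rw [hy i hi, verschiebung_coeff_succ]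
    refine ih (fun i => e i ^ p) (fun j hj => ?_) s y (fun m hm => ?_) i hi m (by omega)
    · obtain ⟨b, hb⟩ := he (j + 1) (by omega)
      exact ⟨b, fun i => by rw [hb, ← pow_mul, pow_succ']⟩
    · have := ha (m + 1) (by omega)
      rwa [h2, verschiebung_coeff_succ] at this

/-- Spanning by successive approximation: expand the first component in the basis, subtract the
Teichmüller lift of the expansion, and apply induction to the remainder divided by `V`, with `e ^ p`
in place of `e`. An additive closure is used because `V` is additive but not linear; it carries
generators for `e ^ p` to generators for `e`. -/
theorem exists_mem_closure_teichmuller_coeff_sub_eq_zero (n : ℕ) :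
    ∀ (e : ι → U), (∀ j < n, ∃ b : Module.Basis ι T U, ∀ i, b i = e i ^ p ^ j) →
    ∀ w : WittVector p U, ∃ y ∈ AddSubgroup.closure (Set.range fun x : WittVector p T × ι =>
      map (algebraMap T U) x.1 * teichmuller p (e x.2)), ∀ m < n, (w - y).coeff m = 0 := by
  induction n with
  | zero => exact fun _ _ _ => ⟨0, zero_mem _, fun m hm => by omega⟩
  | succ n ih =>
    intro e he w
    obtain ⟨b, hb⟩ := he 0 n.succ_pos
    set y₀ := ∑ i ∈ (b.repr (w.coeff 0)).support,
      map (algebraMap T U) (teichmuller p (b.repr (w.coeff 0) i)) * teichmuller p (e i) with hy₀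
    have h0 : (w - y₀).coeff 0 = 0 := by
      rw [coeff_zero_sub, hy₀, coeff_zero_sum, sub_eq_zero]
      conv_lhs => rw [← b.linearCombination_repr (w.coeff 0), Finsupp.linearCombination_apply,
        Finsupp.sum]
      refine Finset.sum_congr rfl fun i _ => ?_
      simp [mul_coeff_zero, hb, Algebra.smul_def]
    obtain ⟨w', hw'⟩ := exists_eq_verschiebung h0
    obtain ⟨y, hy, hwy⟩ := ih (fun i => e i ^ p) (fun j hj => by
      obtain ⟨b, hb⟩ := he (j + 1) (by omega)
      exact ⟨b, fun i => by rw [hb, ← pow_mul, pow_succ']⟩) w'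
    refine ⟨y₀ + verschiebung y, add_mem ?_ ?_, ?_⟩
    · exact sum_mem fun i _ => AddSubgroup.subset_closure ⟨(_, i), rfl⟩
    · have := AddSubgroup.mem_map_of_mem (verschiebung (p := p) (R := U)) hy
      rw [AddMonoidHom.map_closure] at this
      refine AddSubgroup.closure_mono ?_ this
      rintro _ ⟨_, ⟨⟨a, i⟩, rfl⟩, rfl⟩
      exact ⟨(verschiebung a, i), (verschiebung_map_mul_teichmuller_pow _ _ _).symm⟩
    · intro m hm
      rw [← sub_sub, hw', ← map_sub]
      rcases m with _ | m
      · exact verschiebung_coeff_zero _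
      · rw [verschiebung_coeff_succ]; exact hwy m (by omega)

end WittVector

namespace TruncatedWittVector

variable (p : ℕ) [Fact p.Prime] (n : ℕ)

theorem mapRingHom_truncate {R S : Type u} [CommRing R] [CommRing S] (f : R →+* S)
    (x : WittVector p R) :
    mapRingHom p n f (WittVector.truncate n x) = WittVector.truncate n (WittVector.map f x) :=
  RingHom.liftOfRightInverse_comp_apply _ _ _ _ _

/-- The `W_n(T)`-algebra structure of `W_n(U)` for a `T`-algebra `U`. -/
abbrev algebraMap' (T U : Type u) [CommRing T] [CommRing U] [Algebra T U] :
    Algebra (TruncatedWittVector p n T) (TruncatedWittVector p n U) :=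
  (mapRingHom p n (algebraMap T U)).toAlgebra

attribute [local instance] algebraMap'

/-- If all Frobenius twists of `e` are bases of `U` over `T`, then the Teichmüller lifts of `e`
form a basis of `W_n(U)` over `W_n(T)`. -/
theorem exists_basis_teichmuller {ι T U : Type u} [CommRing T] [CommRing U] [Algebra T U]
    (e : ι → U) (he : ∀ j < n, ∃ b : Module.Basis ι T U, ∀ i, b i = e i ^ p ^ j) :
    ∃ b : Module.Basis ι (TruncatedWittVector p n T) (TruncatedWittVector p n U),
      ∀ i, b i = WittVector.truncate n (WittVector.teichmuller p (e i)) := by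
  have hli : LinearIndependent (TruncatedWittVector p n T)
      fun i => WittVector.truncate n (WittVector.teichmuller p (e i)) := by
    rw [linearIndependent_iff']
    intro s a ha i hi
    choose a' ha' using fun i => WittVector.truncate_surjective p n T (a i)
    rw [← ha', ← RingHom.mem_ker, WittVector.mem_ker_truncate]
    refine WittVector.coeff_eq_zero_of_coeff_sum_teichmuller_eq_zero n e he s a' ?_ i hi
    rw [← WittVector.mem_ker_truncate, RingHom.mem_ker, map_sum, ← ha]
    refine Finset.sum_congr rfl fun i _ => ?_
    rw [Algebra.smul_def, RingHom.algebraMap_toAlgebra, ← ha', mapRingHom_truncate, map_mul]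
  refine ⟨Module.Basis.mk hli ?_, fun i => Module.Basis.mk_apply hli _ i⟩
  rintro x -
  obtain ⟨w, rfl⟩ := WittVector.truncate_surjective p n U x
  obtain ⟨y, hy, hwy⟩ :=
    WittVector.exists_mem_closure_teichmuller_coeff_sub_eq_zero (T := T) n e he w
  rw [← WittVector.mem_ker_truncate, RingHom.mem_ker, map_sub, sub_eq_zero] at hwy
  rw [hwy]
  clear hwy
  induction hy using AddSubgroup.closure_induction with
  | mem x hx =>
    obtain ⟨⟨a, i⟩, rfl⟩ := hx
    rw [map_mul, ← mapRingHom_truncate]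
    exact Submodule.smul_mem _ (WittVector.truncate n a) (Submodule.subset_span ⟨i, rfl⟩)
  | zero => rw [map_zero]; exact zero_mem _
  | add x y _ _ hx hy => rw [map_add]; exact add_mem hx hy
  | neg x _ hx => rw [map_neg]; exact neg_mem hx

end TruncatedWittVector

/-! ### Reducedness, flatness and base change. -/

section CommutativeAlgebra

/-- Integral closure commutes with smooth base change. If `s` is nilpotent, `s ⊗ X` is integral over
`S`, so it comes from `S` tensored with the integral closure of `k` in `k[X]`. The elements of the
latter have no linear term, so the coefficient `s` of `X` vanishes. -/
theorem isReduced_of_smooth_field (k S : Type*) [Field k] [CommRing S] [Algebra k S]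
    [Algebra.Smooth k S] : IsReduced S := by
  refine ⟨fun s hs => ?_⟩
  have hint : IsIntegral S (s ⊗ₜ[k] (Polynomial.X : Polynomial k)) := by
    have : IsNilpotent (s ⊗ₜ[k] (Polynomial.X : Polynomial k)) := by
      obtain ⟨n, hn⟩ := hs
      exact ⟨n, by rw [Algebra.TensorProduct.tmul_pow, hn, TensorProduct.zero_tmul]⟩
    obtain ⟨n, hn⟩ := this
    exact ⟨Polynomial.X ^ n, Polynomial.monic_X_pow n, by simp [hn]⟩
  obtain ⟨y, hy⟩ :=
    (TensorProduct.toIntegralClosure_bijective_of_smooth (R := k) (S := S)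
      (B := Polynomial k)).2 ⟨_, hint⟩
  have hy' : Algebra.TensorProduct.map (AlgHom.id S S) (integralClosure k (Polynomial k)).val y
      = s ⊗ₜ Polynomial.X := congrArg Subtype.val hy
  have hC : ∀ q ∈ integralClosure k (Polynomial k), Polynomial.coeff q 1 = 0 := by
    intro q hq
    by_contra h
    have h1 : q.natDegree ≠ 0 := fun h0 => h (Polynomial.coeff_eq_zero_of_natDegree_lt (by omega))
    have := (Polynomial.transcendental_X k).aeval q h1 (mem_nonZeroDivisors_of_ne_zero
      (Polynomial.leadingCoeff_ne_zero.2 fun h0 => h (by simp [h0])))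
    rw [Polynomial.aeval_X_left_apply] at this
    exact this hq.isAlgebraic
  let c : S ⊗[k] Polynomial k →ₗ[k] S := (TensorProduct.rid k S).toLinearMap ∘ₗ
    (Polynomial.lcoeff k 1).lTensor S
  have h0 : ∀ y : S ⊗[k] integralClosure k (Polynomial k),
      c (Algebra.TensorProduct.map (AlgHom.id S S) (integralClosure k (Polynomial k)).val y) = 0 := by
    intro y
    induction y with
    | zero => simp
    | add x y hx hy => rw [map_add, map_add, hx, hy, add_zero]
    | tmul x y => simp [c, hC y.1 y.2]
  have := h0 y
  rw [hy'] at this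
  simpa [c] using this

/-- A linear map into a flat module that is injective modulo a nilpotent maximal ideal is
universally injective. -/
theorem injective_lTensor_of_isTorsionBy (A : Type u) [CommRing A] [IsLocalRing A]
    {C D : Type u} [AddCommGroup C] [Module A C] [AddCommGroup D] [Module A D]
    (φ : C →ₗ[A] D)
    (hφ : Function.Injective (φ.lTensor (IsLocalRing.ResidueField A)))
    (M : Type u) [AddCommGroup M] [Module A M]
    (hM : Module.IsTorsionBySet A M (IsLocalRing.maximalIdeal A)) :
    Function.Injective (φ.lTensor M) := by
  let k := IsLocalRing.ResidueField A
  let : Module k M := hM.module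
  have : IsScalarTower A k M := hM.isScalarTower
  -- `M` is a vector space over `k` and `M ⊗[A] C = M ⊗[k] (k ⊗[A] C)`, so flatness over the field
  -- suffices.
  let φk : k ⊗[A] C →ₗ[k] k ⊗[A] D := φ.baseChange k
  have h1 : Function.Injective (φk.lTensor M) :=
    Module.Flat.lTensor_preserves_injective_linearMap φk hφ
  have h2 := AlgebraTensorModule.lTensor_comp_cancelBaseChange (R := A) (A := k) (B := k) (M := M) φ
  intro x y hxy
  obtain ⟨x, rfl⟩ := (AlgebraTensorModule.cancelBaseChange A k k M C).surjective x
  obtain ⟨y, rfl⟩ := (AlgebraTensorModule.cancelBaseChange A k k M C).surjective y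
  congr 1
  apply h1
  apply (AlgebraTensorModule.cancelBaseChange A k k M D).injective
  have hx := LinearMap.congr_fun h2 x
  have hy := LinearMap.congr_fun h2 y
  exact hx.symm.trans (hxy.trans hy)

/-- Dévissage along `0 → 𝔪M → M → M/𝔪M → 0`: the quotient is the vector space case, `𝔪M` is killed
by a smaller power of `𝔪`, and flatness of `D` keeps `𝔪M ⊗ D → M ⊗ D` injective. -/
theorem injective_lTensor_of_flat (A : Type u) [CommRing A] [IsLocalRing A]
    {C D : Type u} [AddCommGroup C] [Module A C] [AddCommGroup D] [Module A D] [Module.Flat A D]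
    (φ : C →ₗ[A] D)
    (hφ : Function.Injective (φ.lTensor (IsLocalRing.ResidueField A))) (N : ℕ) :
    ∀ (M : Type u) [AddCommGroup M] [Module A M],
    (∀ a ∈ IsLocalRing.maximalIdeal A ^ N, ∀ x : M, a • x = 0) →
    Function.Injective (φ.lTensor M) := by
  induction N with
  | zero =>
    intro M _ _ hM
    have : Subsingleton M := ⟨fun x y => by
      rw [← one_smul A x, ← one_smul A y, hM 1 (by simp), hM 1 (by simp)]⟩
    exact Function.injective_of_subsingleton _
  | succ N ih =>
    intro M _ _ hM
    let M' : Submodule A M := IsLocalRing.maximalIdeal A • ⊤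
    have hM' : ∀ a ∈ IsLocalRing.maximalIdeal A ^ N, ∀ x : M', a • x = 0 := by
      rintro a ha ⟨x, hx⟩
      ext
      change a • x = 0
      refine Submodule.smul_induction_on hx (fun r hr m _ => ?_) fun x y hx hy => ?_
      · rw [smul_smul]; exact hM _ (by rw [pow_succ]; exact Ideal.mul_mem_mul ha hr) m
      · rw [smul_add, hx, hy, add_zero]
    have hq : Module.IsTorsionBySet A (M ⧸ M') (IsLocalRing.maximalIdeal A) := by
      rintro x ⟨a, ha⟩
      obtain ⟨x, rfl⟩ := M'.mkQ_surjective x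
      change a • M'.mkQ x = 0
      rw [← map_smul, ← LinearMap.mem_ker, Submodule.ker_mkQ]
      exact Submodule.smul_mem_smul ha trivial
    have hex : Function.Exact (M'.subtype.rTensor C) (M'.mkQ.rTensor C) :=
      rTensor_exact C (LinearMap.exact_subtype_mkQ M') M'.mkQ_surjective
    rw [injective_iff_map_eq_zero]
    intro x hx
    have h1 : M'.mkQ.rTensor C x = 0 := by
      apply injective_lTensor_of_isTorsionBy A φ hφ _ hq
      rw [map_zero, ← LinearMap.comp_apply, LinearMap.lTensor_comp_rTensor,
        ← LinearMap.rTensor_comp_lTensor, LinearMap.comp_apply, hx, map_zero]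
    obtain ⟨y, rfl⟩ := (hex x).1 h1
    rw [← LinearMap.comp_apply, LinearMap.lTensor_comp_rTensor,
        ← LinearMap.rTensor_comp_lTensor, LinearMap.comp_apply] at hx
    have h2 := Module.Flat.rTensor_preserves_injective_linearMap (M := D) M'.subtype
      M'.injective_subtype
    have h3 : y = 0 := ih M' hM' ((h2 (hx.trans (map_zero _).symm)).trans (map_zero _).symm)
    rw [h3, map_zero]

/-- Comparison of base changes along algebras with bases that correspond to each other. -/
theorem injective_lift_tensor_of_basis {ι W A P Q V : Type u} [CommRing W] [CommRing A]
    [Algebra W A] [CommRing P] [Algebra W P] [CommRing Q] [Algebra W Q] [CommRing V] [Algebra W V]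
    (f : P →ₐ[W] V) (g : Q →ₐ[W] V) (b : Module.Basis ι W Q)
    (hli : letI := f.toRingHom.toAlgebra; ∃ c : Module.Basis ι P V, ∀ i, c i = g (b i)) :
    Function.Injective (Algebra.TensorProduct.lift
      (Algebra.TensorProduct.map (AlgHom.id A A) f) (Algebra.TensorProduct.map (AlgHom.id A A) g)
      (fun _ _ => Commute.all _ _) : (A ⊗[W] P) ⊗[A] (A ⊗[W] Q) →ₐ[A] A ⊗[W] V) := by
  classical
  let := f.toRingHom.toAlgebra
  have : IsScalarTower W P V := .of_algebraMap_eq' f.comp_algebraMap.symm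
  obtain ⟨c, hc⟩ := hli
  -- Coordinates with respect to `c`, tensored with `A`. By `key`, following the map with `Ψ` gives
  -- the coordinates in the base-changed basis `bD`, which determine the element.
  let Ψ : A ⊗[W] V →ₗ[A] ι →₀ (A ⊗[W] P) :=
    (TensorProduct.finsuppRight W A A P ι).toLinearMap ∘ₗ
      (c.repr.toLinearMap.restrictScalars W).baseChange A
  let bD : Module.Basis ι (A ⊗[W] P) ((A ⊗[W] P) ⊗[A] (A ⊗[W] Q)) :=
    (b.baseChange A).baseChange (A ⊗[W] P)
  have key : ∀ x, Ψ (Algebra.TensorProduct.lift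
      (Algebra.TensorProduct.map (AlgHom.id A A) f) (Algebra.TensorProduct.map (AlgHom.id A A) g)
      (fun _ _ => Commute.all _ _) x) = bD.repr x := by
    intro x
    induction x with
    | zero => simp
    | add x y hx hy => simp only [map_add, hx, hy]
    | tmul x y =>
      induction x with
      | zero => simp
      | add x y hx hy => simp only [TensorProduct.add_tmul, map_add, hx, hy]
      | tmul a w =>
        induction y with
        | zero => simp
        | add x y hx hy => simp only [TensorProduct.tmul_add, map_add, hx, hy]
        | tmul a' q =>
          obtain ⟨l, rfl⟩ := b.repr.symm.surjective q
          induction l using Finsupp.induction_linear with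
          | zero => simp
          | add x y hx hy => simp only [TensorProduct.tmul_add, map_add, hx, hy]
          | single i r =>
            have h1 : f w * g (r • b i) = (r • w) • c i := by
              rw [hc, map_smul, mul_smul_comm, smul_assoc]
              rfl
            have h2 : bD.repr ((a ⊗ₜ[W] w) ⊗ₜ[A] (a' ⊗ₜ[W] (r • b i))) =
                Finsupp.single i ((a * a') ⊗ₜ[W] (r • w)) := by
              have h3 : (a ⊗ₜ[W] w) ⊗ₜ[A] (a' ⊗ₜ[W] (r • b i)) =
                  ((a * a') ⊗ₜ[W] (r • w)) • bD i := by
                have h4 : a' ⊗ₜ[W] (r • b i) = (r • a') • ((1 : A) ⊗ₜ[W] b i) := by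
                  rw [← TensorProduct.smul_tmul, TensorProduct.smul_tmul', smul_eq_mul, mul_one]
                have h5 : (r • a') • (a ⊗ₜ[W] w) = (a * a') ⊗ₜ[W] (r • w) := by
                  rw [TensorProduct.smul_tmul', smul_eq_mul, ← TensorProduct.smul_tmul,
                    smul_mul_assoc, mul_comm a']
                rw [Module.Basis.baseChange_apply, Module.Basis.baseChange_apply, h4,
                  ← TensorProduct.smul_tmul, h5, TensorProduct.smul_tmul', smul_eq_mul, mul_one]
              rw [h3, map_smul, Module.Basis.repr_self, Finsupp.smul_single, smul_eq_mul, mul_one]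
            rw [Module.Basis.repr_symm_single, h2]
            simp only [Algebra.TensorProduct.lift_tmul, Algebra.TensorProduct.map_tmul,
              Algebra.TensorProduct.tmul_mul_tmul, AlgHom.coe_id, id_eq]
            rw [h1]
            simp [Ψ, TensorProduct.finsuppRight_apply_tmul]
  intro x y hxy
  apply bD.repr.injective
  ext1
  rw [← key, ← key, hxy]

end CommutativeAlgebra

/-! ### Test algebras over the residue field. -/

open IsLocalRing

namespace TruncatedWittVector

variable (p : ℕ) [Fact p.Prime]

/-- The first component, as a ring homomorphism. -/
def constantCoeff (m : ℕ) (R : Type u) [CommRing R] : TruncatedWittVector p (m + 1) R →+* R :=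
  RingHom.liftOfSurjective (WittVector.truncate (m + 1))
    (WittVector.truncate_surjective p (m + 1) R) ⟨WittVector.constantCoeff, fun x hx =>
      (WittVector.mem_ker_truncate (m + 1) x).1 hx 0 m.succ_pos⟩

theorem constantCoeff_apply (m : ℕ) (R : Type u) [CommRing R]
    (x : TruncatedWittVector p (m + 1) R) : constantCoeff p m R x = x.coeff 0 := by
  obtain ⟨y, rfl⟩ := WittVector.truncate_surjective p (m + 1) R x
  rw [constantCoeff, RingHom.liftOfSurjective_comp_apply, WittVector.coeff_truncate]
  rfl

theorem exists_eq_natCast_mul (m : ℕ) (R : Type u) [CommRing R] [CharP R p] [PerfectRing R p]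
    (x : TruncatedWittVector p (m + 1) R) (hx : x.coeff 0 = 0) :
    ∃ y, x = (p : TruncatedWittVector p (m + 1) R) * y := by
  obtain ⟨w, rfl⟩ := WittVector.truncate_surjective p (m + 1) R x
  have hw : w ∈ Ideal.span {(p : WittVector p R) ^ 1} := by
    rw [WittVector.mem_span_p_pow_iff_le_coeff_eq_zero]
    intro i hi
    obtain rfl : i = 0 := by omega
    simpa [WittVector.coeff_truncate] using hx
  obtain ⟨v, rfl⟩ := Ideal.mem_span_singleton.1 hw
  exact ⟨WittVector.truncate (m + 1) v, by rw [pow_one, map_mul, map_natCast]⟩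

end TruncatedWittVector

/-- Frobenius twists of bases over a perfect field are bases. -/
theorem Module.Basis.exists_pow_frobenius {ι k T : Type*} [Field k] [CommRing T] [Algebra k T]
    (p : ℕ) [Fact p.Prime] [CharP k p] [PerfectRing k p] [CharP T p] [PerfectRing T p]
    (b : Module.Basis ι k T) (j : ℕ) : ∃ b' : Module.Basis ι k T, ∀ i, b' i = b i ^ p ^ j := by
  let φ := iterateFrobeniusEquiv T p j
  let ψ := iterateFrobeniusEquiv k p j
  -- Undo Frobenius on `T`, take coordinates, then apply Frobenius to them: the two semilinearities
  -- cancel, so `ε` is `k`-linear.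
  let ε : T ≃+ (ι →₀ k) := φ.symm.toAddEquiv.trans
    (b.repr.toAddEquiv.trans (Finsupp.mapRange.addEquiv ψ.toAddEquiv))
  refine ⟨.ofRepr { ε with map_smul' := fun c x => ?_ }, fun i => ?_⟩
  · change ε (c • x) = c • ε x
    obtain ⟨c, rfl⟩ := ψ.surjective c
    obtain ⟨x, rfl⟩ := φ.surjective x
    have : ψ c • φ x = φ (c • x) := by
      simp [φ, ψ, iterateFrobeniusEquiv_apply, iterateFrobenius_def, Algebra.smul_def, mul_pow]
    rw [this]
    ext i
    simp [ε]
  · change ε.symm (Finsupp.single i 1) = _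
    rw [AddEquiv.symm_apply_eq]
    have : b i ^ p ^ j = φ (b i) := by
      simp [φ, iterateFrobeniusEquiv_apply, iterateFrobenius_def]
    rw [this]
    ext i
    simp [ε]

/-- Algebras over which `W_n` behaves like a flat lift, and that receive a given reduced algebra. -/
theorem exists_wittFlat_algebra (k : Type u) [Field k] (p : ℕ) [Fact p.Prime] (m : ℕ)
    (h : (CharP k p ∧ PerfectRing k p) ∨ m = 0) (S : Type u) [CommRing S] [Algebra k S]
    [IsReduced S] :
    ∃ (T : CommAlgCat.{u} k) (j : S →ₐ[k] T), Function.Injective j ∧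
      (∃ (ι : Type u) (e : ι → T), ∀ i < m + 1, ∃ b : Module.Basis ι k T,
        ∀ x, b x = e x ^ p ^ i) ∧
      ∀ w : TruncatedWittVector p (m + 1) T, w.coeff 0 = 0 →
        ∃ (c : TruncatedWittVector p (m + 1) k) (w' : TruncatedWittVector p (m + 1) T),
          c.coeff 0 = 0 ∧
          w = TruncatedWittVector.mapRingHom p (m + 1) (algebraMap k T) c * w' := by
  -- With one Witt component only the untwisted basis is needed and the kernel of the first
  -- component is zero, so `S` itself works in any characteristic.
  by_cases hm : m = 0
  · subst hm
    refine ⟨CommAlgCat.of k S, AlgHom.id k S, Function.injective_id,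
      ⟨_, Module.Basis.ofVectorSpace k S, fun i hi => ⟨Module.Basis.ofVectorSpace k S, ?_⟩⟩, ?_⟩
    · obtain rfl : i = 0 := by omega
      simp
    · intro w hw
      refine ⟨0, 0, by simp, ?_⟩
      rw [mul_zero]
      ext i
      obtain rfl : i = 0 := Fin.ext (by omega)
      simpa using hw
  · obtain ⟨_, _⟩ := h.resolve_right hm
    -- The zero ring does not have characteristic `p`; it is treated with the empty basis.
    cases subsingleton_or_nontrivial S
    · refine ⟨CommAlgCat.of k S, AlgHom.id k S, Function.injective_id,
        ⟨PEmpty, PEmpty.elim, fun i hi => ⟨(Module.Basis.empty S : Module.Basis PEmpty k S), nofun⟩⟩, ?_⟩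
      intro w _
      have : Subsingleton (CommAlgCat.of k S) := inferInstanceAs (Subsingleton S)
      exact ⟨0, 0, by simp, TruncatedWittVector.ext fun _ => Subsingleton.elim _ _⟩
    · have : CharP S p := charP_of_injective_algebraMap (algebraMap k S).injective p
      let : Algebra k (PerfectClosure S p) :=
        ((PerfectClosure.of S p).comp (algebraMap k S)).toAlgebra
      let T := CommAlgCat.of k (PerfectClosure S p)
      have : CharP T p := inferInstanceAs (CharP (PerfectClosure S p) p)
      have : PerfectRing T p := inferInstanceAs (PerfectRing (PerfectClosure S p) p)
      refine ⟨T, ⟨PerfectClosure.of S p, fun _ => rfl⟩, fun x y hxy => ?_,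
        ⟨_, Module.Basis.ofVectorSpace k T, fun i _ =>
          Module.Basis.exists_pow_frobenius p (Module.Basis.ofVectorSpace k T) i⟩,
        fun w hw => ?_⟩
      · exact ((PerfectClosure.eq_iff S p (0, x) (0, y)).1 hxy :)
      -- Over a perfect ring the kernel of the first component is generated by `p`, which already
      -- lies in `W(k)`.
      · obtain ⟨w', rfl⟩ := TruncatedWittVector.exists_eq_natCast_mul p m _ w hw
        refine ⟨p, w', ?_, by rw [map_natCast]⟩
        rw [← TruncatedWittVector.constantCoeff_apply, map_natCast, CharP.cast_eq_zero]

/-! ### Lifting the special fibre. -/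

section Lift

attribute [local instance] TruncatedWittVector.algebraMap'

theorem exists_maximalIdeal_pow_eq_bot (A : Type*) [CommRing A] [IsLocalRing A]
    [IsArtinianRing A] : ∃ N, maximalIdeal A ^ N = ⊥ := by
  have := IsArtinianRing.isNilpotent_jacobson_bot (R := A)
  rwa [jacobson_eq_maximalIdeal _ bot_ne_top] at this

variable (A : Type u) [CommRing A] [IsLocalRing A] [IsArtinianRing A]
    (p : ℕ) [Fact p.Prime] (m : ℕ)
    [Algebra (TruncatedWittVector p (m + 1) (ResidueField A)) A]

/-- A morphism from the special fibre of a smooth algebra to `T` lifts to `A ⊗ W(T)`. -/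
theorem exists_lift_greenberg
    (hA : ∀ x : TruncatedWittVector p (m + 1) (ResidueField A),
      residue A (algebraMap _ A x) = x.coeff 0)
    (T : Type u) [CommRing T] [Algebra (ResidueField A) T]
    (hT : ∀ w : TruncatedWittVector p (m + 1) T, w.coeff 0 = 0 →
        ∃ (c : TruncatedWittVector p (m + 1) (ResidueField A))
          (w' : TruncatedWittVector p (m + 1) T), c.coeff 0 = 0 ∧
          w = TruncatedWittVector.mapRingHom p (m + 1) (algebraMap (ResidueField A) T) c * w')
    (C : Type u) [CommRing C] [Algebra A C] [Algebra.FormallySmooth A C]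
    (j : ResidueField A ⊗[A] C →ₐ[ResidueField A] T) (hj : Function.Injective j) :
    ∃ v : C →ₐ[A] A ⊗[TruncatedWittVector p (m + 1) (ResidueField A)]
        TruncatedWittVector p (m + 1) T,
      Function.Injective (v.toLinearMap.lTensor (ResidueField A)) := by
  let k := ResidueField A
  let W := TruncatedWittVector p (m + 1) k
  let WT := TruncatedWittVector p (m + 1) T
  let : Algebra A T := ((algebraMap k T).comp (algebraMap A k)).toAlgebra
  have : IsScalarTower A k T := .of_algebraMap_eq' rfl
  let : Algebra W T := ((algebraMap A T).comp (algebraMap W A)).toAlgebra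
  have : IsScalarTower W A T := .of_algebraMap_eq' rfl
  let c₀ : WT →ₐ[W] T :=
    { TruncatedWittVector.constantCoeff p m T with
      commutes' := fun x => by
        change TruncatedWittVector.constantCoeff p m T
          (TruncatedWittVector.mapRingHom p (m + 1) (algebraMap k T) x) =
          algebraMap k T (residue A (algebraMap W A x))
        rw [hA, TruncatedWittVector.constantCoeff_apply, TruncatedWittVector.coeff_mapRingHom] }
  have hc₀ : ∀ w : WT, c₀ w = w.coeff 0 := TruncatedWittVector.constantCoeff_apply p m T
  let D := A ⊗[W] WT
  -- Reduction `a ⊗ w ↦ ā · w₀`. Its kernel turns out to be `𝔪D`, hence nilpotent, so formal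
  -- smoothness lifts maps along `q`.
  let q : D →ₐ[A] T := Algebra.TensorProduct.lift (Algebra.ofId A T) c₀ fun _ _ => Commute.all _ _
  have hq : ∀ w : WT, q ((1 : A) ⊗ₜ[W] w) = w.coeff 0 := fun w => by
    rw [← hc₀]
    exact (Algebra.TensorProduct.lift_tmul _ _ _ _ _).trans (by rw [map_one, one_mul])
  let J : Ideal D := (maximalIdeal A).map (algebraMap A D)
  have hqJ : ∀ x ∈ J, q x = 0 := by
    intro x hx
    rw [← RingHom.mem_ker]
    refine (Ideal.map_le_iff_le_comap.2 fun a ha => ?_) hx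
    rw [Ideal.mem_comap, RingHom.mem_ker, AlgHom.commutes]
    change algebraMap k T (residue A a) = 0
    rw [(residue_eq_zero_iff a).2 ha, map_zero]
  have htmul : ∀ a ∈ maximalIdeal A, ∀ w : WT, a ⊗ₜ[W] w ∈ J := by
    intro a ha w
    have : a ⊗ₜ[W] w = algebraMap A D a * (1 : A) ⊗ₜ[W] w := by
      rw [Algebra.TensorProduct.algebraMap_apply, Algebra.TensorProduct.tmul_mul_tmul, mul_one,
        one_mul]
      rfl
    rw [this]
    exact Ideal.mul_mem_right _ _ (Ideal.mem_map_of_mem _ ha)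
  -- Modulo `𝔪`, each `a` is the image of the Teichmüller lift of its residue, a scalar that can be
  -- moved across the tensor sign.
  have hred : ∀ x : D, ∃ w : WT, x - (1 : A) ⊗ₜ[W] w ∈ J := by
    intro x
    induction x using TensorProduct.induction_on with
    | zero => exact ⟨0, by simp⟩
    | add x y hx hy =>
      obtain ⟨w, hw⟩ := hx
      obtain ⟨w', hw'⟩ := hy
      refine ⟨w + w', ?_⟩
      rw [TensorProduct.tmul_add, add_sub_add_comm]
      exact add_mem hw hw'
    | tmul a w =>
      let c : W := WittVector.truncate (m + 1) (WittVector.teichmuller p (residue A a))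
      refine ⟨c • w, ?_⟩
      rw [← TensorProduct.smul_tmul, ← TensorProduct.sub_tmul]
      refine htmul _ ?_ w
      rw [← residue_eq_zero_iff, map_sub, Algebra.smul_def, mul_one, hA,
        WittVector.coeff_truncate]
      exact sub_eq_zero.2 (WittVector.teichmuller_coeff_zero p _).symm
  have hker : RingHom.ker (q : D →+* T) ≤ J := by
    intro x hx
    obtain ⟨w, hw⟩ := hred x
    have h1 : w.coeff 0 = 0 := by
      have := hqJ _ hw
      rwa [map_sub, show q x = 0 from hx, zero_sub, neg_eq_zero, hq] at this
    -- The factor `c` from `W(k)` moves to the left of the tensor sign, where it lands in `𝔪`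
    -- because `c₀ = 0`.
    obtain ⟨c, w', hc, rfl⟩ := hT w h1
    have h2 : (1 : A) ⊗ₜ[W]
        (TruncatedWittVector.mapRingHom p (m + 1) (algebraMap k T) c * w') ∈ J := by
      change (1 : A) ⊗ₜ[W] (c • w') ∈ J
      rw [← TensorProduct.smul_tmul]
      refine htmul _ ?_ w'
      rw [← residue_eq_zero_iff, Algebra.smul_def, mul_one, hA, hc]
    exact (sub_add_cancel x _ ▸ add_mem hw h2 :)
  have hsurj : Function.Surjective q := fun t =>
    ⟨(1 : A) ⊗ₜ[W] WittVector.truncate (m + 1) (WittVector.teichmuller p t), by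
      rw [hq, WittVector.coeff_truncate]
      exact WittVector.teichmuller_coeff_zero p _⟩
  have hnil : IsNilpotent (RingHom.ker (q : D →+* T)) := by
    obtain ⟨N, hN⟩ := exists_maximalIdeal_pow_eq_bot A
    refine ⟨N, le_bot_iff.1 ((Ideal.pow_right_mono hker N).trans ?_)⟩
    rw [← Ideal.map_pow, hN, Ideal.map_bot]
  let j' : C →ₐ[A] T := (j.restrictScalars A).comp Algebra.TensorProduct.includeRight
  let v : C →ₐ[A] D := Algebra.FormallySmooth.liftOfSurjective j' q hsurj hnil
  have hv : ∀ x, q (v x) = j' x := Algebra.FormallySmooth.liftOfSurjective_apply j' q hsurj hnil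
  refine ⟨v, ?_⟩
  -- Composing `k ⊗ v` with `r` recovers the injection `j`, so `k ⊗ v` is injective.
  let r : k ⊗[A] D →ₐ[k] T := Algebra.TensorProduct.lift (Algebra.ofId k T) q
    fun _ _ => Commute.all _ _
  have hr : ∀ x : k ⊗[A] C, r (v.toLinearMap.lTensor k x) = j x := by
    intro x
    induction x with
    | zero => simp
    | add x y hx hy => rw [map_add, map_add, map_add, hx, hy]
    | tmul x y =>
      rw [LinearMap.lTensor_tmul]
      simp only [r, Algebra.TensorProduct.lift_tmul, AlgHom.toLinearMap_apply, hv]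
      change algebraMap k T x * j (1 ⊗ₜ y) = _
      rw [← AlgHom.commutes j, ← map_mul]
      simp
  intro x y hxy
  apply hj
  rw [← hr, ← hr, hxy]

end Lift

/-! ### Enough points in the rings `A ⊗ W(U)`. -/

section Density

variable (A : Type u) [CommRing A] [IsLocalRing A] [IsArtinianRing A]
    (p : ℕ) [Fact p.Prime] (m : ℕ)
    [Algebra (TruncatedWittVector p (m + 1) (ResidueField A)) A]

/-- A smooth `A`-algebra `C` acquires enough points in rings `A ⊗ W(T)`. -/
theorem exists_injective_greenbergRing
    (hk : (CharP (ResidueField A) p ∧ PerfectRing (ResidueField A) p) ∨ m = 0)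
    (hA : ∀ x : TruncatedWittVector p (m + 1) (ResidueField A),
      residue A (algebraMap _ A x) = x.coeff 0)
    (C : Type u) [CommRing C] [Algebra A C] [Algebra.Smooth A C]
    (T : CommAlgCat.{u} (ResidueField A)) :
    ∃ (U : CommAlgCat.{u} (ResidueField A)) (i : T ⟶ U)
      (θ : CommAlgCat.of A ((greenbergRing p (m + 1) (ResidueField A) A).obj T ⊗[A] C) ⟶
        (greenbergRing p (m + 1) (ResidueField A) A).obj U),
      Function.Injective θ.hom ∧
      CommAlgCat.ofHom Algebra.TensorProduct.includeLeft ≫ θ =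
        (greenbergRing p (m + 1) (ResidueField A) A).map i := by
  let k := ResidueField A
  let W := TruncatedWittVector p (m + 1) k
  have : IsReduced (k ⊗[A] C) := isReduced_of_smooth_field k _
  obtain ⟨T', j, hj, ⟨ι, e, he⟩, hT'⟩ := exists_wittFlat_algebra k p m hk (k ⊗[A] C)
  obtain ⟨v, hv⟩ := exists_lift_greenberg A p m hA T' hT' C j hj
  let U := CommAlgCat.of k (T ⊗[k] T')
  let iT : T ⟶ U := CommAlgCat.ofHom Algebra.TensorProduct.includeLeft
  let iT' : T' ⟶ U := CommAlgCat.ofHom Algebra.TensorProduct.includeRight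
  let P := wittAlgObj p (m + 1) k T
  let Q := wittAlgObj p (m + 1) k T'
  let V := wittAlgObj p (m + 1) k U
  let f : P →ₐ[W] V := wittAlgMap p (m + 1) k iT
  let g : Q →ₐ[W] V := wittAlgMap p (m + 1) k iT'
  obtain ⟨b, hb⟩ := TruncatedWittVector.exists_basis_teichmuller p (m + 1) (T := k) e he
  -- The twists of `1 ⊗ e` are base changes of the twists of `e`, so their Teichmüller lifts, images
  -- of the basis `b`, form a basis of `W(U)` over `W(T)`.
  obtain ⟨c, hc⟩ := TruncatedWittVector.exists_basis_teichmuller p (m + 1) (T := T)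
    (U := T ⊗[k] T') (fun i => 1 ⊗ₜ e i) fun i hi => by
      obtain ⟨b, hb⟩ := he i hi
      refine ⟨b.baseChange T, fun x => ?_⟩
      rw [Module.Basis.baseChange_apply, hb, Algebra.TensorProduct.tmul_pow, one_pow]
  have hinj := injective_lift_tensor_of_basis (A := A) f g b ⟨c, fun i => by
    refine (hc i).trans (Eq.trans ?_ (congrArg g (hb i)).symm)
    refine Eq.trans ?_ (TruncatedWittVector.mapRingHom_truncate p (m + 1) (iT'.hom : T' →+* U) _).symm
    rw [WittVector.map_teichmuller]
    rfl⟩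
  let R := A ⊗[W] P
  let D := A ⊗[W] Q
  have : Module.Free W Q := .of_basis b
  have : Module.Flat A D := Module.Flat.baseChange W A Q
  obtain ⟨N, hN⟩ := exists_maximalIdeal_pow_eq_bot A
  have hR : Function.Injective (v.toLinearMap.lTensor R) :=
    have h0 : ∀ a ∈ maximalIdeal A ^ N, ∀ x : R, a • x = 0 := fun a ha x => by
      rw [hN, Ideal.mem_bot] at ha
      rw [ha, zero_smul]
    @injective_lTensor_of_flat A _ _ C D _ _ _ _ this v.toLinearMap hv N R _ _ h0
  -- The composite `R ⊗ C → R ⊗ D → A ⊗ W(U)` of the two injections `hR` and `hinj`.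
  let θ : R ⊗[A] C →ₐ[A] A ⊗[W] V := (Algebra.TensorProduct.lift
      (Algebra.TensorProduct.map (AlgHom.id A A) f) (Algebra.TensorProduct.map (AlgHom.id A A) g)
      (fun _ _ => Commute.all _ _)).comp (Algebra.TensorProduct.map (AlgHom.id A R) v)
  refine ⟨U, iT, CommAlgCat.ofHom θ, ?_, ?_⟩
  · exact hinj.comp hR
  · apply CommAlgCat.hom_ext
    apply AlgHom.ext
    intro x
    change θ (x ⊗ₜ 1) = Algebra.TensorProduct.map (AlgHom.id A A) f x
    refine (Algebra.TensorProduct.lift_tmul _ _ (fun _ _ => Commute.all _ _) _ _).trans ?_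
    have h1 : v.toLinearMap 1 = 1 := map_one v
    refine (congrArg (_ * ·) ((congrArg _ h1).trans
      (map_one (Algebra.TensorProduct.map (AlgHom.id A A) g)))).trans ?_
    rw [mul_one]
    rfl

end Density

/-! ### Normalisers and the universal point. -/

section Normaliser

variable {A : Type u} [CommRing A]

/-- Conjugation by a point over `R` preserves a closed subscheme `H` with coordinate ring `C` as
soon as this can be tested after an injective base change of `R ⊗ C`. -/
theorem conj_mem_of_injective (G : RGroupFunctor A) (H : Subfunctor G.toRFunctor)
    (B : CommAlgCat.{u} A) (e : G.toRFunctor.CorepresentableBy B) (I : Ideal B)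
    (hI : ∀ (S : CommAlgCat.{u} A) (f : B ⟶ S), e.homEquiv f ∈ H.obj S ↔ ∀ b ∈ I, f.hom b = 0)
    (R : CommAlgCat.{u} A) (g : G.obj R) (E : CommAlgCat.{u} A)
    (θ : CommAlgCat.of A (R ⊗[A] (B ⧸ I)) ⟶ E) (hθ : Function.Injective θ.hom)
    (hE : ∀ y ∈ H.obj E, (G.map (CommAlgCat.ofHom Algebra.TensorProduct.includeLeft ≫ θ) g * y *
      (G.map (CommAlgCat.ofHom Algebra.TensorProduct.includeLeft ≫ θ) g)⁻¹ : G.obj E) ∈ H.obj E)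
    (S : CommAlgCat.{u} A) (f : R ⟶ S) (y : G.obj S) (hy : y ∈ H.obj S) :
    (G.map f g * y * (G.map f g)⁻¹ : G.obj S) ∈ H.obj S := by
  let X := CommAlgCat.of A (R ⊗[A] (B ⧸ I))
  let iL : R ⟶ X := CommAlgCat.ofHom Algebra.TensorProduct.includeLeft
  let π : B ⟶ X := CommAlgCat.ofHom
    (Algebra.TensorProduct.includeRight.comp (Ideal.Quotient.mkₐ A I))
  -- The universal point of `H` over `R`; every point of `H` over an `R`-algebra is a specialisation
  -- of it, through the map `h` below.
  let yu : G.obj X := e.homEquiv π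
  have hyu : yu ∈ H.obj X := (hI X π).2 fun b hb => by
    change (1 : R) ⊗ₜ[A] (Ideal.Quotient.mk I b) = 0
    rw [Ideal.Quotient.eq_zero_iff_mem.2 hb, TensorProduct.tmul_zero]
  let z : G.obj X := G.map iL g * yu * (G.map iL g)⁻¹
  have hconj : ∀ {S' : CommAlgCat.{u} A} (h : X ⟶ S'),
      G.map h z = G.map (iL ≫ h) g * G.map h yu * (G.map (iL ≫ h) g)⁻¹ := by
    intro S' h
    simp [z]
  have hz : z ∈ H.obj X := by
    obtain ⟨φ, hφ⟩ := e.homEquiv.surjective z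
    rw [← hφ]
    refine (hI X φ).2 fun b hb => ?_
    have h1 : e.homEquiv (φ ≫ θ) ∈ H.obj E := by
      rw [e.homEquiv_comp, hφ]
      change G.map θ z ∈ H.obj E
      rw [hconj]
      exact hE _ (H.map θ hyu)
    apply hθ
    rw [map_zero]
    exact (hI E _).1 h1 b hb
  obtain ⟨ψ, rfl⟩ := e.homEquiv.surjective y
  have hψ := (hI S ψ).1 hy
  have hcomm : ∀ x y, Commute (f.hom x) (Ideal.Quotient.liftₐ I ψ.hom hψ y) :=
    fun _ _ => Commute.all _ _
  let h : X ⟶ S := CommAlgCat.ofHom (Algebra.TensorProduct.lift f.hom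
    (Ideal.Quotient.liftₐ I ψ.hom hψ) hcomm)
  have hf : iL ≫ h = f := by
    ext x
    refine (Algebra.TensorProduct.lift_tmul _ _ hcomm x 1).trans ?_
    rw [map_one, mul_one]
  have hy' : G.map h yu = e.homEquiv ψ := by
    have : π ≫ h = ψ := by
      ext x
      refine (Algebra.TensorProduct.lift_tmul _ _ hcomm _ _).trans ?_
      rw [map_one, one_mul]
      rfl
    rw [← this]
    exact (e.homEquiv_comp h π).symm
  have := H.map h hz
  rw [Set.mem_preimage] at this
  change G.map h z ∈ _ at this
  rwa [hconj, hf, hy'] at this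

end Normaliser

theorem mainTheorem5
    (A : Type u) [CommRing A] [IsLocalRing A] [IsArtinianRing A]
    [IsAlgClosed (IsLocalRing.ResidueField A)]
    (p : ℕ) [Fact p.Prime] (m : ℕ)
    (hchar : ringChar A = p ^ (m + 1) ∨ (ringChar A = 0 ∧ m = 0))
    [Algebra (TruncatedWittVector p (m + 1) (IsLocalRing.ResidueField A)) A]
    (hA : ∀ x : TruncatedWittVector p (m + 1) (IsLocalRing.ResidueField A),
      IsLocalRing.residue A (algebraMap _ A x) = x.coeff 0)
    (G : RGroupFunctor A) (hG : G.toRFunctor.IsAffineOfFiniteType)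
    (H : Subfunctor G.toRFunctor) (hH : IsSubgroupFunctor G H)
    (hHsmooth : IsClosedSmoothSubscheme H)
    (hN : IsClosedSmoothSubscheme (normaliser G H)) :
    greenbergSub p (m + 1) (IsLocalRing.ResidueField A) A (normaliser G H) =
      normaliser ((greenbergGroup p (m + 1) (IsLocalRing.ResidueField A) A).obj G)
        (greenbergSub p (m + 1) (IsLocalRing.ResidueField A) A H) := by
  have hk : (CharP (ResidueField A) p ∧ PerfectRing (ResidueField A) p) ∨ m = 0 := by
    refine hchar.imp (fun h => ?_) And.right
    have : CharP (ResidueField A) p := by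
      refine (CharP.charP_iff_prime_eq_zero Fact.out).2 ?_
      rw [← map_natCast (residue A), residue_eq_zero_iff]
      exact natCast_mem_maximalIdeal_of_ringChar h
    exact ⟨this, PerfectField.toPerfectRing p⟩
  obtain ⟨B, e, I, hI, _⟩ := hHsmooth
  let F := greenbergRing p (m + 1) (ResidueField A) A
  have key : ∀ (T : CommAlgCat.{u} (ResidueField A)) (g : G.obj (F.obj T)),
      (∀ (U : CommAlgCat.{u} (ResidueField A)) (i : T ⟶ U), ∀ y ∈ H.obj (F.obj U),
        (G.map (F.map i) g * y * (G.map (F.map i) g)⁻¹ : G.obj (F.obj U)) ∈ H.obj (F.obj U)) →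
      ∀ (S : CommAlgCat.{u} A) (f : F.obj T ⟶ S), ∀ y ∈ H.obj S,
        (G.map f g * y * (G.map f g)⁻¹ : G.obj S) ∈ H.obj S := by
    intro T g hg S f y hy
    obtain ⟨U, i, θ, hθ, hi⟩ := exists_injective_greenbergRing A p m hk hA (B ⧸ I) T
    refine conj_mem_of_injective G H B e I hI (F.obj T) g (F.obj U) θ hθ ?_ S f y hy
    rw [hi]
    exact hg U i
  ext T g
  refine ⟨fun hg U i => hg (F.obj U) (F.map i), fun hg => ?_⟩
  change G.obj (F.obj T) at g
  have hg' : ∀ (U : CommAlgCat.{u} (ResidueField A)) (i : T ⟶ U),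
      (fun y : G.obj (F.obj U) => G.map (F.map i) g * y * (G.map (F.map i) g)⁻¹) ''
        H.obj (F.obj U) = H.obj (F.obj U) := hg
  have h1 := key T g fun U i y hy => (hg' U i).subset ⟨y, hy, rfl⟩
  -- The argument yields only inclusions; applied to `g⁻¹` it supplies preimages, hence equality.
  have h2 := key T g⁻¹ fun U i y hy => by
    obtain ⟨x, hx, rfl⟩ := (hg' U i).symm.subset hy
    simpa [mul_assoc] using hx
  intro S f
  refine Set.Subset.antisymm ?_ fun y hy => ⟨_, h2 S f y hy, ?_⟩
  · rintro _ ⟨y, hy, rfl⟩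
    exact h1 S f y hy
  · simp [mul_assoc]
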